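/- For $0<\beta<1$ let $L(\beta)=\sum_{n=1}^\infty \frac{\beta^n}{1-\beta^n}$ be the Lambert series, and let $\vartheta_2,\vartheta_3$ be the Jacobi theta functions, so that $\vartheta_2(0,q)=\sum_{n\in\mathbb Z}q^{(n+1/2)^2}$ and $\vartheta_3(0,q)=\sum_{n\in\mathbb Z}q^{n^2}$ for $0<q<1$. For a modulus $\mu\in(0,1)$ let \[ K(\mu)=\int_0^1\frac{ds}{\sqrt{(1-s^2)(1-\mu^2s^2)}},\qquad q(\mu)=\exp\!\Big(-\pi\,\frac{K(\sqrt{1-\mu^2})}{K(\mu)}\Big) \] be the complete elliptic integral and the nome and, with $q=q(\mu)$, put \[ g(x,\mu)=(1-q)\sum_{j=0}^\infty \frac{q^j}{1-q^{2j+1}}\,\sqrt2\,\sin\big((2j+1)\pi x\big). \] **Theorem.** Let $q_0\in(0,1)$ be such that \[ \frac{L(\sqrt{q_0})-2L(q_0)+L(q_0^2)}{\sqrt{q_0}}=\frac{2}{1-q_0}, \qquad\text{and let}\qquad \mu_0=\frac{\vartheta_2^2(0,q_0)}{\vartheta_3^2(0,q_0)}. \] Then $1-\mu_0<10^{-7}$.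 Moreover, if $\{\mu_n\}_{n=1}^\infty\subset(0,1)$ and $\sup_n\mu_n<\mu_0$, then $\{g(n\,\cdot,\mu_n)\}_{n=1}^\infty$ is a Riesz basis of $L^2(0,1)$ (with real or complex scalars), that is, the image of an orthonormal basis under a bounded linear operator with bounded inverse. -/

import Mathlib

namespace JacobiBasis

/-- The Lambert series `L(β) = ∑_{n ≥ 1} βⁿ / (1 - βⁿ)`, for `0 < β < 1`. -/
noncomputable def lambert (β : ℝ) : ℝ :=
  ∑' n : ℕ, β ^ (n + 1) / (1 - β ^ (n + 1))

/-- The Jacobi theta function `ϑ₂(z, q) = ∑_{n ∈ ℤ} q^{(n + 1/2)²} cos((2n + 1)z)`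
(that is `2 ∑_{n ≥ 0} q^{(n + 1/2)²} cos((2n + 1)z)`), for real `z` and `0 < q < 1`. -/
noncomputable def theta2 (z q : ℝ) : ℝ :=
  ∑' n : ℤ, q ^ (((n : ℝ) + 1 / 2) ^ 2 : ℝ) * Real.cos ((2 * (n : ℝ) + 1) * z)

/-- The Jacobi theta function `ϑ₃(z, q) = ∑_{n ∈ ℤ} q^{n²} cos(2nz)`
(that is `1 + 2 ∑_{n ≥ 1} q^{n²} cos(2nz)`), for real `z` and `0 < q < 1`. -/
noncomputable def theta3 (z q : ℝ) : ℝ :=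
  ∑' n : ℤ, q ^ ((n : ℝ) ^ 2 : ℝ) * Real.cos (2 * (n : ℝ) * z)

/-- The complete elliptic integral of the first kind `K(μ)`, as a function of the modulus `μ`. -/
noncomputable def ellipticK (μ : ℝ) : ℝ :=
  ∫ s in (0 : ℝ)..1, 1 / (√(1 - s ^ 2) * √(1 - μ ^ 2 * s ^ 2))

/-- The nome `q = exp(-π K'(μ) / K(μ))` of the modulus `μ`, where `K'(μ) = K(√(1 - μ²))`. -/
noncomputable def nome (μ : ℝ) : ℝ :=
  Real.exp (-(Real.pi * ellipticK (√(1 - μ ^ 2)) / ellipticK μ))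

/-- The sine functions `e_k(x) = √2 sin(kπx)`. -/
noncomputable def sineFun (k : ℕ) (x : ℝ) : ℝ :=
  √2 * Real.sin (k * Real.pi * x)

/-- The normalised eigenfunction
`g(x, μ) = (1 - q) ∑_{j ≥ 0} q^j / (1 - q^{2j+1}) e_{2j+1}(x)`, where `q` is the nome of `μ`. -/
noncomputable def g (x μ : ℝ) : ℝ :=
  (1 - nome μ) *
    ∑' j : ℕ, nome μ ^ j / (1 - nome μ ^ (2 * j + 1)) * sineFun (2 * j + 1) x

/-- A Riesz basis of a Hilbert space: a family which is the image of an orthonormal basis under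
a bounded linear operator with bounded inverse. -/
def IsRieszBasis {ι : Type*} (𝕜 : Type*) [RCLike 𝕜] {H : Type*} [NormedAddCommGroup H]
    [InnerProductSpace 𝕜 H] (f : ι → H) : Prop :=
  ∃ (b : HilbertBasis ι 𝕜 H) (A : H ≃L[𝕜] H), ∀ i, A (b i) = f i

end JacobiBasis

/-! In the sine basis, `g(n·, μ)` equals `∑ⱼ coeff q j • e_{(2j+1)n}` with `coeff q 0 = 1`. The map
`e_n ↦ g(n·, μ_n)` is therefore the identity plus weighted shifts along the injections `n ↦
(2j+1)n`, `j ≥ 1`, each of norm at most the supremum of its weights. If these bounds sum to less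
than one, a Neumann series inverts the operator (`isRieszBasis_of_hasSum`).

The coefficients increase with `q` (`coeff_le_coeff`), and the Lambert equation says exactly that
those with `j ≥ 1` sum to one at `q₀` (`tsum_coeff_eq_two`). It remains to see that `μ < μ₀` forces
`nome μ < q₀`: the nome is strictly increasing, and `nome_thetaModulus` identifies `nome μ₀` with
`q₀`. That inversion rests on the fact that `K / ϑ₃²` is unchanged when `t` is doubled (Landen),
hence equals its limit `K(0)`, and on the inversion `t ↦ 1/t`, which exchanges the modulus with its
complement.

The numerical bound uses that inversion too: the equation keeps `q₀` away from 0, so the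
complementary modulus, a theta quotient at `1/t`, is tiny. -/

namespace JacobiBasis

open Real Filter Topology

/-! ### Theta constants as Gaussian sums, and the modulus they define. -/

/-- The Gaussian sum `∑_{n ∈ ℤ} exp(-π t (n + c)²)`. -/
noncomputable def gaussSum (c t : ℝ) : ℝ := ∑' n : ℤ, exp (-π * t * ((n : ℝ) + c) ^ 2)

theorem summable_gauss (c : ℝ) {t : ℝ} (ht : 0 < t) :
    Summable fun n : ℤ => exp (-π * t * ((n : ℝ) + c) ^ 2) := by
  refine Summable.of_nonneg_of_le (fun n => (exp_pos _).le) (fun n => ?_)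
    (summable_pow_mul_jacobiTheta₂_term_bound (t * |c|) ht 0)
  rw [pow_zero, one_mul, exp_le_exp]
  have h1 : -((n : ℝ) * c) ≤ |c| * |(n : ℝ)| := by
    rw [← abs_mul, mul_comm c]; exact neg_le_abs _
  have h2 : 0 ≤ t * c ^ 2 + 2 * t * ((n : ℝ) * c + |c| * |(n : ℝ)|) := by
    have := mul_nonneg ht.le (by linarith : 0 ≤ (n : ℝ) * c + |c| * |(n : ℝ)|)
    nlinarith [mul_nonneg ht.le (sq_nonneg c)]
  push_cast
  nlinarith [mul_nonneg pi_pos.le h2]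

theorem gaussSum_pos (c : ℝ) {t : ℝ} (ht : 0 < t) : 0 < gaussSum c t :=
  (summable_gauss c ht).tsum_pos (fun _ => (exp_pos _).le) 0 (exp_pos _)

theorem gaussSum_add_one (c t : ℝ) : gaussSum (c + 1) t = gaussSum c t := by
  unfold gaussSum
  rw [← (Equiv.addRight (1 : ℤ)).tsum_eq (fun n : ℤ => exp (-π * t * ((n : ℝ) + c) ^ 2))]
  refine tsum_congr fun n => ?_
  simp only [Equiv.coe_addRight, Int.cast_add, Int.cast_one]
  ring_nf

/-- Pairs of integers of equal parity come from the first branch, those of opposite parity from the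
second. -/
theorem bijective_sum_diff :
    Function.Bijective (Sum.elim (fun p : ℤ × ℤ => (p.1 + p.2, p.1 - p.2))
      (fun p : ℤ × ℤ => (p.1 + p.2 + 1, p.1 - p.2))) := by
  constructor
  · rintro (⟨a, b⟩ | ⟨a, b⟩) (⟨c, d⟩ | ⟨c, d⟩) h <;>
      simp only [Sum.elim_inl, Sum.elim_inr, Prod.mk.injEq, Sum.inl.injEq, Sum.inr.injEq,
        reduceCtorEq] at h ⊢ <;> omega
  · rintro ⟨m, n⟩
    rcases Int.even_or_odd (m + n) with ⟨k, hk⟩ | ⟨k, hk⟩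
    · exact ⟨Sum.inl (k, m - k), by simp only [Sum.elim_inl, Prod.mk.injEq]; omega⟩
    · exact ⟨Sum.inr (k, m - k - 1), by simp only [Sum.elim_inr, Prod.mk.injEq]; omega⟩

/-- The product formula obtained from the substitution `(m, n) ↦ (m + n, m - n)`. -/
theorem gaussSum_mul_gaussSum (c d : ℝ) {t : ℝ} (ht : 0 < t) :
    gaussSum c t * gaussSum d t =
      gaussSum ((c + d) / 2) (2 * t) * gaussSum ((c - d) / 2) (2 * t) +
      gaussSum ((c + d + 1) / 2) (2 * t) * gaussSum ((c - d + 1) / 2) (2 * t) := by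
  have h2t : 0 < 2 * t := by positivity
  have hs := fun (c : ℝ) => (summable_gauss c ht).norm
  have hs2 := fun (c : ℝ) => (summable_gauss c h2t).norm
  unfold gaussSum
  rw [tsum_mul_tsum_of_summable_norm (hs c) (hs d), tsum_mul_tsum_of_summable_norm (hs2 _) (hs2 _),
    tsum_mul_tsum_of_summable_norm (hs2 _) (hs2 _),
    ← (Equiv.ofBijective _ bijective_sum_diff).tsum_eq]
  rw [Summable.tsum_sum]
  · congr 1 <;> refine tsum_congr fun p => ?_ <;> rw [← exp_add, ← exp_add] <;> congr 1 <;>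
      simp <;> ring
  · have := summable_mul_of_summable_norm (hs2 ((c + d) / 2)) (hs2 ((c - d) / 2))
    refine this.congr fun p => ?_
    simp only [Function.comp_apply, Equiv.ofBijective_apply, Sum.elim_inl]
    rw [← exp_add, ← exp_add]
    congr 1
    push_cast
    ring
  · have := summable_mul_of_summable_norm (hs2 ((c + d + 1) / 2)) (hs2 ((c - d + 1) / 2))
    refine this.congr fun p => ?_
    simp only [Function.comp_apply, Equiv.ofBijective_apply, Sum.elim_inr]
    rw [← exp_add, ← exp_add]
    congr 1
    push_cast
    ring

theorem sq_gaussSum_zero {t : ℝ} (ht : 0 < t) :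
    gaussSum 0 t ^ 2 = gaussSum 0 (2 * t) ^ 2 + gaussSum (1 / 2) (2 * t) ^ 2 := by
  rw [sq, gaussSum_mul_gaussSum 0 0 ht]
  norm_num
  ring

theorem sq_gaussSum_half {t : ℝ} (ht : 0 < t) :
    gaussSum (1 / 2) t ^ 2 = 2 * gaussSum 0 (2 * t) * gaussSum (1 / 2) (2 * t) := by
  rw [sq, gaussSum_mul_gaussSum _ _ ht]
  have := gaussSum_add_one 0 (2 * t)
  norm_num at this ⊢
  rw [this]
  ring

theorem bijective_even_odd :
    Function.Bijective (Sum.elim (fun n : ℤ => 2 * n) (fun n : ℤ => 2 * n + 1)) := by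
  constructor
  · rintro (a | a) (c | c) h <;>
      simp only [Sum.elim_inl, Sum.elim_inr, Sum.inl.injEq, Sum.inr.injEq,
        reduceCtorEq] at h ⊢ <;> omega
  · intro m
    rcases Int.even_or_odd m with ⟨k, hk⟩ | ⟨k, hk⟩
    · exact ⟨Sum.inl k, by simp only [Sum.elim_inl]; omega⟩
    · exact ⟨Sum.inr k, by simp only [Sum.elim_inr]; omega⟩

theorem gaussSum_zero_eq_add {t : ℝ} (ht : 0 < t) :
    gaussSum 0 t = gaussSum 0 (4 * t) + gaussSum (1 / 2) (4 * t) := by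
  have h4t : 0 < 4 * t := by positivity
  unfold gaussSum
  rw [← (Equiv.ofBijective _ bijective_even_odd).tsum_eq, Summable.tsum_sum]
  · congr 1 <;> refine tsum_congr fun p => ?_ <;> congr 1 <;> simp <;> ring
  · refine (summable_gauss 0 h4t).congr fun p => ?_
    simp only [Function.comp_apply, Equiv.ofBijective_apply, Sum.elim_inl]
    congr 1
    push_cast
    ring
  · refine (summable_gauss (1 / 2) h4t).congr fun p => ?_
    simp only [Function.comp_apply, Equiv.ofBijective_apply, Sum.elim_inr]
    congr 1
    push_cast
    ring

theorem gaussSum_zero_inv {t : ℝ} (ht : 0 < t) : gaussSum 0 (1 / t) = √t * gaussSum 0 t := by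
  have h := Real.tsum_exp_neg_mul_int_sq ht
  have h1 : gaussSum 0 t = ∑' n : ℤ, exp (-π * t * (n : ℝ) ^ 2) := by simp [gaussSum]
  have h2 : gaussSum 0 (1 / t) = ∑' n : ℤ, exp (-π / t * (n : ℝ) ^ 2) := by
    simp [gaussSum, div_eq_mul_inv]
  rw [h1, h2, h, ← sqrt_eq_rpow]
  have := (sqrt_pos.2 ht).ne'
  field_simp

/-- Only the inversion of `ϑ₃` is needed: apply it at `4 * t` and split the sum at `1 / (4 * t)` by
the parity of the index. -/
theorem gaussSum_half_inv {t : ℝ} (ht : 0 < t) :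
    gaussSum (1 / 2) (1 / t) = √t * (gaussSum 0 (4 * t) - gaussSum (1 / 2) (4 * t)) := by
  have h1 := gaussSum_zero_eq_add ht
  have h2 := gaussSum_zero_inv ht
  have h4 : 0 < 1 / (4 * t) := by positivity
  have h3 := gaussSum_zero_eq_add h4
  have h5 := gaussSum_zero_inv (t := 4 * t) (by positivity)
  have e : 4 * (1 / (4 * t)) = 1 / t := by field_simp
  have hs : √(4 * t) = 2 * √t := by
    rw [sqrt_mul (by norm_num), show (4 : ℝ) = 2 ^ 2 by norm_num, sqrt_sq (by norm_num)]
  rw [e, h5, h2, hs, h1] at h3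
  linarith

theorem sq_gaussSum_half_inv {t : ℝ} (ht : 0 < t) :
    gaussSum (1 / 2) (1 / t) ^ 2 = t * (gaussSum 0 (2 * t) ^ 2 - gaussSum (1 / 2) (2 * t) ^ 2) := by
  have h2t : 0 < 2 * t := by positivity
  have h1 := sq_gaussSum_zero h2t
  have h2 := sq_gaussSum_half h2t
  rw [← mul_assoc, show (2 : ℝ) * 2 = 4 by norm_num] at h1 h2
  rw [gaussSum_half_inv ht, mul_pow, sq_sqrt ht.le, h1, h2]
  ring

/-- The elliptic modulus `ϑ₂² / ϑ₃²` at the nome `exp (-π t)`. -/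
noncomputable def thetaModulus (t : ℝ) : ℝ := gaussSum (1 / 2) t ^ 2 / gaussSum 0 t ^ 2

theorem thetaModulus_pos {t : ℝ} (ht : 0 < t) : 0 < thetaModulus t := by
  have := gaussSum_pos 0 ht
  have := gaussSum_pos (1 / 2) ht
  unfold thetaModulus
  positivity

/-- The complementary modulus belongs to the inverted parameter. -/
theorem sq_thetaModulus_add_sq_thetaModulus_inv {t : ℝ} (ht : 0 < t) :
    thetaModulus t ^ 2 + thetaModulus (1 / t) ^ 2 = 1 := by
  have hA := gaussSum_pos 0 ht
  have hA2 := gaussSum_pos 0 (t := 2 * t) (by positivity)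
  have hB2 := gaussSum_pos (1 / 2) (t := 2 * t) (by positivity)
  have e : gaussSum 0 (1 / t) ^ 2 = t * gaussSum 0 t ^ 2 := by
    rw [gaussSum_zero_inv ht, mul_pow, sq_sqrt ht.le]
  -- With `A`, `B` the two Gaussian sums at `2 * t`, the claim becomes `(2AB)² + (A² - B²)² = (A² +
  -- B²)²`.
  unfold thetaModulus
  rw [sq_gaussSum_half_inv ht, e, sq_gaussSum_half ht, sq_gaussSum_zero ht]
  have : gaussSum 0 (2 * t) ^ 2 + gaussSum (1 / 2) (2 * t) ^ 2 ≠ 0 := by positivity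
  field_simp
  ring

theorem thetaModulus_lt_one {t : ℝ} (ht : 0 < t) : thetaModulus t < 1 := by
  have h1 := sq_thetaModulus_add_sq_thetaModulus_inv ht
  have h2 := thetaModulus_pos (t := 1 / t) (by positivity)
  have h3 := thetaModulus_pos ht
  nlinarith

theorem sqrt_one_sub_sq_thetaModulus {t : ℝ} (ht : 0 < t) :
    √(1 - thetaModulus t ^ 2) = thetaModulus (1 / t) := by
  rw [← eq_sub_of_add_eq' (sq_thetaModulus_add_sq_thetaModulus_inv ht),
    sqrt_sq (thetaModulus_pos (by positivity)).le]

/-- The Landen relation between the moduli at `t` and `2t`. -/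
theorem thetaModulus_eq_landen {t : ℝ} (ht : 0 < t) :
    thetaModulus t = 2 * √(thetaModulus (2 * t)) / (1 + √(thetaModulus (2 * t)) ^ 2) := by
  have hA2 := gaussSum_pos 0 (t := 2 * t) (by positivity)
  have hB2 := gaussSum_pos (1 / 2) (t := 2 * t) (by positivity)
  have e : √(thetaModulus (2 * t)) = gaussSum (1 / 2) (2 * t) / gaussSum 0 (2 * t) := by
    unfold thetaModulus
    rw [← div_pow, sqrt_sq (by positivity)]
  rw [e, thetaModulus, sq_gaussSum_half ht, sq_gaussSum_zero ht]
  field_simp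

theorem sq_gaussSum_zero_eq_landen {t : ℝ} (ht : 0 < t) :
    gaussSum 0 t ^ 2 = (1 + thetaModulus (2 * t)) * gaussSum 0 (2 * t) ^ 2 := by
  have hA2 := gaussSum_pos 0 (t := 2 * t) (by positivity)
  rw [thetaModulus, sq_gaussSum_zero ht]
  field_simp

theorem one_le_gaussSum_zero {t : ℝ} (ht : 0 < t) : 1 ≤ gaussSum 0 t := by
  have := (summable_gauss 0 ht).le_tsum 0 fun j _ => (exp_pos _).le
  simpa [gaussSum] using this

theorem tendsto_gaussSum_zero : Tendsto (gaussSum 0) atTop (𝓝 1) := by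
  have h := tendsto_tsum_of_dominated_convergence (𝓕 := atTop)
    (f := fun (t : ℝ) (n : ℤ) => exp (-π * t * ((n : ℝ) + 0) ^ 2))
    (g := fun n => if n = 0 then 1 else 0) (summable_gauss 0 one_pos) ?_ ?_
  · rwa [tsum_ite_eq] at h
  · intro n
    rcases eq_or_ne n 0 with rfl | hn
    · simp
    · rw [if_neg hn]
      refine tendsto_exp_atBot.comp ?_
      have hn' : (0 : ℝ) < π * (n : ℝ) ^ 2 := by positivity
      have := (tendsto_id (α := ℝ) (x := atTop)).const_mul_atTop_of_neg (neg_neg_of_pos hn')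
      refine this.congr fun t => ?_
      simp only [id, add_zero]; ring
  · filter_upwards [eventually_ge_atTop 1] with t ht n
    rw [norm_of_nonneg (exp_pos _).le, exp_le_exp]
    nlinarith [mul_nonneg (mul_nonneg pi_pos.le (sub_nonneg.2 ht)) (sq_nonneg ((n : ℝ) + 0))]

/-- Every exponent `(n + 1/2)²` is at least `1/4`, so the decay factor can be extracted termwise. -/
theorem gaussSum_half_le {t : ℝ} (ht : 1 ≤ t) :
    gaussSum (1 / 2) t ≤ exp (-π * (t - 1) / 4) * gaussSum (1 / 2) 1 := by
  unfold gaussSum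
  rw [← tsum_mul_left]
  refine (summable_gauss _ (by linarith)).tsum_le_tsum (fun n => ?_)
    ((summable_gauss _ one_pos).mul_left _)
  rw [← exp_add, exp_le_exp]
  have h : (1 : ℝ) / 4 ≤ ((n : ℝ) + 1 / 2) ^ 2 := by
    have : 0 ≤ n * (n + 1) := by
      rcases le_or_gt 0 n with h | h
      · positivity
      · nlinarith
    have : (0 : ℝ) ≤ n * (n + 1) := by exact_mod_cast this
    nlinarith
  nlinarith [mul_nonneg (mul_nonneg pi_pos.le (sub_nonneg.2 ht)) (sub_nonneg.2 h)]

theorem exp_neg_three_lt : exp (-3) < 1 / 4 := by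
  have := exp_one_gt_d9
  rw [exp_neg, one_div, inv_lt_inv₀ (exp_pos _) (by norm_num), show (3 : ℝ) = (3 : ℕ) * 1 by norm_num,
    exp_nat_mul]
  calc (4 : ℝ) < 2 ^ 3 := by norm_num
    _ ≤ exp 1 ^ 3 := by gcongr; linarith

theorem gaussSum_half_one_le : gaussSum (1 / 2) 1 ≤ 3 := by
  have hg : HasSum (fun n : ℕ => (1 / 4 : ℝ) ^ n) (4 / 3) := by
    convert hasSum_geometric_of_lt_one (r := (1 / 4 : ℝ)) (by norm_num) (by norm_num) using 1
    norm_num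
  have hle : ∀ n : ℕ, exp (-π * 1 * ((n : ℝ) + 1 / 2) ^ 2) ≤ (1 / 4 : ℝ) ^ n := fun n => by
    calc exp (-π * 1 * ((n : ℝ) + 1 / 2) ^ 2) ≤ exp (n * -3) := by
          rw [exp_le_exp]
          have : (0 : ℝ) ≤ n := n.cast_nonneg
          nlinarith [pi_gt_three, sq_nonneg (n : ℝ)]
      _ = exp (-3) ^ n := exp_nat_mul _ _
      _ ≤ _ := by gcongr; exact exp_neg_three_lt.le
  have hs := summable_gauss (1 / 2) one_pos
  have e1 : Summable fun n : ℕ => exp (-π * 1 * ((n : ℝ) + 1 / 2) ^ 2) :=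
    hg.summable.of_nonneg_of_le (fun _ => (exp_pos _).le) hle
  -- The reflection `n ↦ -(n + 1)` preserves the terms, so the sum is twice its nonnegative half, at
  -- most `8/3`.
  have hsum := HasSum.of_nat_of_neg_add_one
    (f := fun n : ℤ => exp (-π * 1 * ((n : ℝ) + 1 / 2) ^ 2)) 
    (m := ∑' n : ℕ, exp (-π * 1 * ((n : ℝ) + 1 / 2) ^ 2)) e1.hasSum
    (by
      refine e1.hasSum.congr_fun fun n => ?_
      push_cast
      ring_nf)
  rw [gaussSum, hsum.tsum_eq]
  have := hg.tsum_eq ▸ e1.tsum_le_tsum hle hg.summable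
  linarith

theorem tendsto_thetaModulus : Tendsto thetaModulus atTop (𝓝 0) := by
  have h1 : Tendsto (gaussSum (1 / 2)) atTop (𝓝 0) := by
    have : Tendsto (fun t : ℝ => exp (-π * (t - 1) / 4) * gaussSum (1 / 2) 1) atTop (𝓝 0) := by
      rw [← zero_mul (gaussSum (1 / 2) 1)]
      refine Tendsto.mul_const _ (tendsto_exp_atBot.comp ?_)
      have := ((tendsto_atTop_add_const_right atTop (-1) (tendsto_id (α := ℝ))).const_mul_atTop_of_neg
        (r := -(π / 4)) (by linarith [pi_pos]))
      refine this.congr fun t => ?_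
      simp only [id]; ring
    refine squeeze_zero' ?_ ?_ this
    · filter_upwards [eventually_gt_atTop 0] with t ht using (gaussSum_pos _ ht).le
    · filter_upwards [eventually_ge_atTop 1] with t ht using gaussSum_half_le ht
  have h2 : Tendsto thetaModulus atTop (𝓝 (0 ^ 2 / 1 ^ 2)) :=
    (h1.pow 2).div (tendsto_gaussSum_zero.pow 2) (by norm_num)
  simpa using h2

theorem theta3_zero_eq (t : ℝ) : theta3 0 (exp (-π * t)) = gaussSum 0 t := by
  unfold theta3 gaussSum
  refine tsum_congr fun n => ?_
  rw [mul_zero, cos_zero, mul_one, ← exp_mul, add_zero]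

theorem theta2_zero_eq (t : ℝ) : theta2 0 (exp (-π * t)) = gaussSum (1 / 2) t := by
  unfold theta2 gaussSum
  refine tsum_congr fun n => ?_
  rw [mul_zero, cos_zero, mul_one, ← exp_mul]

end JacobiBasis

/-! ### The complete elliptic integral, Landen's transformation and the nome. -/

namespace JacobiBasis

open Real Filter Topology MeasureTheory Set

/-- The integrand of the complete elliptic integral. -/
noncomputable def ellipticIntegrand (μ s : ℝ) : ℝ := 1 / (√(1 - s ^ 2) * √(1 - μ ^ 2 * s ^ 2))

theorem one_sub_mul_sq_pos {μ s : ℝ} (hμ : μ ∈ Ico (0 : ℝ) 1) (hs : s ∈ Ioo (0 : ℝ) 1) :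
    0 < 1 - μ ^ 2 * s ^ 2 := by
  have h1 : μ ^ 2 < 1 := by nlinarith [hμ.1, hμ.2]
  have h2 : s ^ 2 < 1 := by nlinarith [hs.1, hs.2]
  nlinarith [sq_nonneg μ, sq_nonneg s]

theorem ellipticIntegrand_pos {μ s : ℝ} (hμ : μ ∈ Ico (0 : ℝ) 1) (hs : s ∈ Ioo (0 : ℝ) 1) :
    0 < ellipticIntegrand μ s := by
  have h1 : 0 < 1 - s ^ 2 := by nlinarith [hs.1, hs.2]
  have h2 := one_sub_mul_sq_pos hμ hs
  unfold ellipticIntegrand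
  positivity

theorem ellipticIntegrand_strictMono {μ ν s : ℝ} (hμ : 0 ≤ μ) (hμν : μ < ν) (hν : ν < 1)
    (hs : s ∈ Ioo (0 : ℝ) 1) : ellipticIntegrand μ s < ellipticIntegrand ν s := by
  have h1 : 0 < 1 - s ^ 2 := by nlinarith [hs.1, hs.2]
  have h3 := one_sub_mul_sq_pos ⟨hμ.trans hμν.le, hν⟩ hs
  have h4 : 1 - ν ^ 2 * s ^ 2 < 1 - μ ^ 2 * s ^ 2 := by
    have : μ ^ 2 < ν ^ 2 := by gcongr
    nlinarith [pow_pos hs.1 2]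
  unfold ellipticIntegrand
  have h5 : 0 < √(1 - s ^ 2) := sqrt_pos.2 h1
  have h6 : 0 < √(1 - ν ^ 2 * s ^ 2) := sqrt_pos.2 h3
  have h7 : √(1 - ν ^ 2 * s ^ 2) < √(1 - μ ^ 2 * s ^ 2) := sqrt_lt_sqrt h3.le h4
  gcongr

/-- This gives both integrability and, since the constant tends to 1, the limit of `K` at 0. -/
theorem ellipticIntegrand_le {μ s : ℝ} (hμ : μ ∈ Ico (0 : ℝ) 1) (hs : s ∈ Ioo (0 : ℝ) 1) :
    ellipticIntegrand μ s ≤ 1 / √(1 - μ ^ 2) * ellipticIntegrand 0 s := by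
  have h1 : 0 < 1 - s ^ 2 := by nlinarith [hs.1, hs.2]
  have h2 : 0 < 1 - μ ^ 2 := by nlinarith [hμ.1, hμ.2]
  have h3 : √(1 - μ ^ 2) ≤ √(1 - μ ^ 2 * s ^ 2) := by
    apply sqrt_le_sqrt
    nlinarith [mul_nonneg (sq_nonneg μ) h1.le]
  have h4 := sqrt_pos.2 h1
  have h5 := sqrt_pos.2 h2
  simp only [ellipticIntegrand]
  rw [div_mul_div_comm, mul_one, mul_comm √(1 - μ ^ 2)]
  norm_num only [zero_mul, sub_zero, sqrt_one, mul_one]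
  gcongr

theorem ellipticK_eq (μ : ℝ) : ellipticK μ = ∫ s in Ioo (0 : ℝ) 1, ellipticIntegrand μ s := by
  rw [ellipticK, intervalIntegral.integral_of_le zero_le_one, integral_Ioc_eq_integral_Ioo]
  rfl

theorem integrableOn_ellipticIntegrand_zero : IntegrableOn (ellipticIntegrand 0) (Ioo 0 1) := by
  have h := Polynomial.Chebyshev.intervalIntegrable_sqrt_one_sub_sq_inv
  rw [intervalIntegrable_iff_integrableOn_Ioo_of_le (by norm_num)] at h
  refine (h.mono_set (Ioo_subset_Ioo_left (by norm_num))).congr_fun (fun s _ => ?_) measurableSet_Ioo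
  simp [ellipticIntegrand]

theorem integrableOn_ellipticIntegrand {μ : ℝ} (hμ : μ ∈ Ico (0 : ℝ) 1) :
    IntegrableOn (ellipticIntegrand μ) (Ioo 0 1) := by
  refine (integrableOn_ellipticIntegrand_zero.const_mul (1 / √(1 - μ ^ 2))).mono' ?_ ?_
  · apply Measurable.aestronglyMeasurable
    unfold ellipticIntegrand
    fun_prop
  · filter_upwards [ae_restrict_mem measurableSet_Ioo] with s hs
    rw [norm_of_nonneg (ellipticIntegrand_pos hμ hs).le]
    exact ellipticIntegrand_le hμ hs

theorem integral_Ioo_pos {f : ℝ → ℝ} (hf : IntegrableOn f (Ioo 0 1))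
    (h : ∀ s ∈ Ioo (0 : ℝ) 1, 0 < f s) : 0 < ∫ s in Ioo (0 : ℝ) 1, f s := by
  rw [← integral_Ioc_eq_integral_Ioo, ← intervalIntegral.integral_of_le zero_le_one]
  refine intervalIntegral.intervalIntegral_pos_of_pos_on ?_ h one_pos
  rwa [intervalIntegrable_iff_integrableOn_Ioo_of_le zero_le_one]

theorem ellipticK_pos {μ : ℝ} (hμ : μ ∈ Ico (0 : ℝ) 1) : 0 < ellipticK μ := by
  rw [ellipticK_eq]
  exact integral_Ioo_pos (integrableOn_ellipticIntegrand hμ) fun s => ellipticIntegrand_pos hμ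

theorem ellipticK_strictMonoOn : StrictMonoOn ellipticK (Ico 0 1) := by
  intro μ hμ ν hν h
  have h1 := integrableOn_ellipticIntegrand hμ
  have h2 := integrableOn_ellipticIntegrand hν
  rw [← sub_pos, ellipticK_eq, ellipticK_eq, ← integral_sub h2 h1]
  exact integral_Ioo_pos (h2.sub h1) fun s hs =>
    sub_pos.2 (ellipticIntegrand_strictMono hμ.1 h hν.2 hs)

theorem ellipticK_le {μ : ℝ} (hμ : μ ∈ Ico (0 : ℝ) 1) :
    ellipticK μ ≤ 1 / √(1 - μ ^ 2) * ellipticK 0 := by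
  rw [ellipticK_eq, ellipticK_eq, ← integral_const_mul]
  exact setIntegral_mono_on (integrableOn_ellipticIntegrand hμ)
    (integrableOn_ellipticIntegrand_zero.const_mul _) measurableSet_Ioo
    fun s => ellipticIntegrand_le hμ

theorem tendsto_ellipticK_zero : Tendsto ellipticK (𝓝[≥] 0) (𝓝 (ellipticK 0)) := by
  have h : Tendsto (fun μ : ℝ => 1 / √(1 - μ ^ 2) * ellipticK 0) (𝓝[≥] 0) (𝓝 (ellipticK 0)) := by
    have : ContinuousAt (fun μ : ℝ => 1 / √(1 - μ ^ 2) * ellipticK 0) 0 :=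
      ContinuousAt.mul (ContinuousAt.div (by fun_prop) (by fun_prop) (by norm_num)) (by fun_prop)
    have h2 := this.tendsto.mono_left (nhdsWithin_le_nhds (s := Ici 0))
    simpa using h2
  have hev : ∀ᶠ μ : ℝ in 𝓝[≥] 0, μ ∈ Ico (0 : ℝ) 1 := Ico_mem_nhdsGE one_pos
  refine tendsto_of_tendsto_of_tendsto_of_le_of_le' tendsto_const_nhds h ?_ ?_
  · filter_upwards [hev] with μ hμ
    exact ellipticK_strictMonoOn.monotoneOn ⟨le_rfl, one_pos⟩ hμ hμ.1
  · filter_upwards [hev] with μ hμ using ellipticK_le hμ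

/-- The substitution of the ascending Landen transformation. -/
noncomputable def landenSubst (k x : ℝ) : ℝ := (1 + k) * x / (1 + k * x ^ 2)

theorem hasDerivAt_landenSubst {k : ℝ} (hk : 0 ≤ k) (x : ℝ) :
    HasDerivAt (landenSubst k) ((1 + k) * (1 - k * x ^ 2) / (1 + k * x ^ 2) ^ 2) x := by
  have h0 : 1 + k * x ^ 2 ≠ 0 := by positivity
  have h1 : HasDerivAt (fun x : ℝ => (1 + k) * x) ((1 + k) * 1) x := (hasDerivAt_id x).const_mul _
  have h2 : HasDerivAt (fun x : ℝ => 1 + k * x ^ 2) (k * (2 * x)) x := by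
    simpa using ((hasDerivAt_pow 2 x).const_mul k).const_add 1
  refine (h1.fun_div h2 h0).congr_deriv ?_
  ring

theorem strictMonoOn_landenSubst {k : ℝ} (hk : k ∈ Ico (0 : ℝ) 1) :
    StrictMonoOn (landenSubst k) (Icc 0 1) := by
  refine strictMonoOn_of_deriv_pos (convex_Icc 0 1)
    (fun x _ => (hasDerivAt_landenSubst hk.1 x).continuousAt.continuousWithinAt) fun x hx => ?_
  rw [interior_Icc] at hx
  rw [(hasDerivAt_landenSubst hk.1 x).deriv]
  have h1 : 0 < 1 - k * x ^ 2 := by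
    have : x ^ 2 < 1 := by nlinarith [hx.1, hx.2]
    nlinarith [hk.1, hk.2, sq_nonneg x]
  have := hk.1
  positivity

theorem landenSubst_image_Ioo {k : ℝ} (hk : k ∈ Ico (0 : ℝ) 1) :
    landenSubst k '' Ioo 0 1 = Ioo 0 1 := by
  have hm := strictMonoOn_landenSubst hk
  have h0 : landenSubst k 0 = 0 := by simp [landenSubst]
  have h1 : landenSubst k 1 = 1 := by
    have : 1 + k ≠ 0 := by linarith [hk.1]
    simp [landenSubst, this]
  apply Subset.antisymm
  · rintro _ ⟨x, hx, rfl⟩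
    have a := hm (left_mem_Icc.2 zero_le_one) (Ioo_subset_Icc_self hx) hx.1
    have b := hm (Ioo_subset_Icc_self hx) (right_mem_Icc.2 zero_le_one) hx.2
    exact ⟨h0 ▸ a, h1 ▸ b⟩
  · have := intermediate_value_Ioo (f := landenSubst k) zero_le_one
      fun x _ => (hasDerivAt_landenSubst hk.1 x).continuousAt.continuousWithinAt
    rwa [h0, h1] at this

/-- With `k = r²`, the numerators under the roots factor: `(1 + kx²)² - (1 + k)²x² = (1 - x²)(1 -
k²x²)` and `(1 + kx²)² - 4kx² = (1 - kx²)²`. The second cancels against the derivative of the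
substitution. -/
theorem ellipticIntegrand_landenSubst {r x : ℝ} (hr : r ∈ Ico (0 : ℝ) 1) (hx : x ∈ Ioo (0 : ℝ) 1) :
    |(1 + r ^ 2) * (1 - r ^ 2 * x ^ 2) / (1 + r ^ 2 * x ^ 2) ^ 2| *
        ellipticIntegrand (2 * r / (1 + r ^ 2)) (landenSubst (r ^ 2) x) =
      (1 + r ^ 2) * ellipticIntegrand (r ^ 2) x := by
  have h1 : 0 < 1 - x ^ 2 := by nlinarith [hx.1, hx.2]
  have h2 := one_sub_mul_sq_pos hr hx
  have h3 : 0 < 1 - (r ^ 2) ^ 2 * x ^ 2 :=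
    one_sub_mul_sq_pos ⟨sq_nonneg r, by nlinarith [hr.1, hr.2]⟩ hx
  have h4 : 0 < 1 + r ^ 2 * x ^ 2 := by positivity
  have e1 : √(1 - landenSubst (r ^ 2) x ^ 2) =
      √(1 - x ^ 2) * √(1 - (r ^ 2) ^ 2 * x ^ 2) / (1 + r ^ 2 * x ^ 2) := by
    rw [← sqrt_mul h1.le, ← sqrt_sq h4.le, ← sqrt_div (by positivity)]
    congr 1
    unfold landenSubst
    field_simp
    ring
  have e2 : √(1 - (2 * r / (1 + r ^ 2)) ^ 2 * landenSubst (r ^ 2) x ^ 2) =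
      (1 - r ^ 2 * x ^ 2) / (1 + r ^ 2 * x ^ 2) := by
    rw [← sqrt_sq (by positivity : 0 ≤ (1 - r ^ 2 * x ^ 2) / (1 + r ^ 2 * x ^ 2))]
    congr 1
    unfold landenSubst
    field_simp
    ring
  have h5 := sqrt_pos.2 h1
  have h6 := sqrt_pos.2 h3
  rw [abs_of_nonneg (by positivity), ellipticIntegrand, e1, e2, ellipticIntegrand]
  field_simp

/-- The ascending Landen transformation. -/
theorem ellipticK_landen {r : ℝ} (hr : r ∈ Ico (0 : ℝ) 1) :
    ellipticK (2 * r / (1 + r ^ 2)) = (1 + r ^ 2) * ellipticK (r ^ 2) := by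
  have hk : r ^ 2 ∈ Ico (0 : ℝ) 1 := ⟨sq_nonneg r, by nlinarith [hr.1, hr.2]⟩
  rw [ellipticK_eq, ellipticK_eq, ← integral_const_mul]
  conv_lhs => rw [← landenSubst_image_Ioo hk]
  rw [integral_image_eq_integral_abs_deriv_smul measurableSet_Ioo
    (fun x _ => (hasDerivAt_landenSubst hk.1 x).hasDerivWithinAt)
    ((strictMonoOn_landenSubst hk).injOn.mono Ioo_subset_Icc_self)]
  exact setIntegral_congr_fun measurableSet_Ioo fun x hx => ellipticIntegrand_landenSubst hr hx

theorem thetaModulus_mem_Ico {t : ℝ} (ht : 0 < t) : thetaModulus t ∈ Ico (0 : ℝ) 1 :=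
  ⟨(thetaModulus_pos ht).le, thetaModulus_lt_one ht⟩

/-- Numerator and denominator both acquire the factor `1 + thetaModulus (2 * t)`. -/
theorem ellipticK_thetaModulus_div_double {t : ℝ} (ht : 0 < t) :
    ellipticK (thetaModulus t) / gaussSum 0 t ^ 2 =
      ellipticK (thetaModulus (2 * t)) / gaussSum 0 (2 * t) ^ 2 := by
  have h2t : 0 < 2 * t := by positivity
  have h := thetaModulus_mem_Ico h2t
  have hr : √(thetaModulus (2 * t)) ∈ Ico (0 : ℝ) 1 :=
    ⟨sqrt_nonneg _, by rw [sqrt_lt' one_pos]; linarith [h.2]⟩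
  have hA := gaussSum_pos 0 h2t
  have := h.1
  rw [thetaModulus_eq_landen ht, ellipticK_landen hr, sq_gaussSum_zero_eq_landen ht, sq_sqrt h.1]
  field_simp

/-- Jacobi's formula `K = C ϑ₃²`, where `C = K(0)`. -/
theorem ellipticK_thetaModulus {t : ℝ} (ht : 0 < t) :
    ellipticK (thetaModulus t) = ellipticK 0 * gaussSum 0 t ^ 2 := by
  have hc : ∀ n : ℕ, ellipticK (thetaModulus (2 ^ n * t)) / gaussSum 0 (2 ^ n * t) ^ 2 =
      ellipticK (thetaModulus t) / gaussSum 0 t ^ 2 := fun n => by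
    induction n with
    | zero => simp
    | succ n ih =>
      rw [← ih, ellipticK_thetaModulus_div_double (t := 2 ^ n * t) (by positivity), pow_succ',
        mul_assoc]
  -- Repeated doubling sends the modulus to 0 and `ϑ₃` to 1. The value of `K(0)` is never needed, as
  -- it cancels in the nome.
  have hT : Tendsto (fun n : ℕ => (2 : ℝ) ^ n * t) atTop atTop :=
    (tendsto_pow_atTop_atTop_of_one_lt one_lt_two).atTop_mul_const ht
  have hk : Tendsto (fun n : ℕ => thetaModulus (2 ^ n * t)) atTop (𝓝[≥] 0) :=
    tendsto_nhdsWithin_iff.2 ⟨tendsto_thetaModulus.comp hT,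
      Eventually.of_forall fun n => (thetaModulus_pos (by positivity)).le⟩
  have hlim := (tendsto_ellipticK_zero.comp hk).div ((tendsto_gaussSum_zero.comp hT).pow 2)
    (by norm_num)
  have hlim' : Tendsto (fun _ : ℕ => ellipticK (thetaModulus t) / gaussSum 0 t ^ 2) atTop
      (𝓝 (ellipticK 0 / 1 ^ 2)) := hlim.congr hc
  have := tendsto_nhds_unique hlim' tendsto_const_nhds
  have hA := gaussSum_pos 0 ht
  rw [one_pow, div_one] at this
  rw [this]
  field_simp

/-- Jacobi's inversion: the nome of `ϑ₂² / ϑ₃²` at `exp (-π t)` is `exp (-π t)`. -/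
theorem nome_thetaModulus {t : ℝ} (ht : 0 < t) : nome (thetaModulus t) = exp (-π * t) := by
  have hK := ellipticK_pos ⟨le_rfl, one_pos⟩
  have hA := gaussSum_pos 0 ht
  rw [nome, sqrt_one_sub_sq_thetaModulus ht, ellipticK_thetaModulus (by positivity),
    ellipticK_thetaModulus ht, gaussSum_zero_inv ht, mul_pow, sq_sqrt ht.le]
  congr 1
  field_simp

theorem sqrt_one_sub_sq_mem_Ico {μ : ℝ} (hμ : μ ∈ Ioo (0 : ℝ) 1) : √(1 - μ ^ 2) ∈ Ico (0 : ℝ) 1 :=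
  ⟨sqrt_nonneg _, by rw [sqrt_lt' one_pos]; nlinarith [hμ.1]⟩

/-- As the modulus grows, `K` increases and the complementary integral decreases. -/
theorem nome_strictMonoOn : StrictMonoOn nome (Ioo 0 1) := by
  intro μ hμ ν hν h
  have h1 := ellipticK_strictMonoOn ⟨hμ.1.le, hμ.2⟩ ⟨hν.1.le, hν.2⟩ h
  have h2 := ellipticK_strictMonoOn (sqrt_one_sub_sq_mem_Ico hν) (sqrt_one_sub_sq_mem_Ico hμ)
    (sqrt_lt_sqrt (by nlinarith [hν.1, hν.2]) (by nlinarith [hμ.1]))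
  have h3 := ellipticK_pos ⟨hμ.1.le, hμ.2⟩
  have h4 := ellipticK_pos (sqrt_one_sub_sq_mem_Ico hν)
  unfold nome
  rw [exp_lt_exp, neg_lt_neg_iff]
  have h5 := h4.trans h2
  have := pi_pos
  gcongr

theorem nome_mem_Ioo {μ : ℝ} (hμ : μ ∈ Ioo (0 : ℝ) 1) : nome μ ∈ Ioo (0 : ℝ) 1 := by
  have h3 := ellipticK_pos ⟨hμ.1.le, hμ.2⟩
  have h4 := ellipticK_pos (sqrt_one_sub_sq_mem_Ico hμ)
  have := pi_pos
  refine ⟨exp_pos _, ?_⟩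
  rw [nome, exp_lt_one_iff, neg_lt_zero]
  positivity

end JacobiBasis

/-! ### Monotonicity of the coefficients, the Lambert equation and the numerical bound. -/

namespace JacobiBasis

open Real Filter Topology Set

/-- The coefficient of `e_{2j+1}` in the normalised eigenfunction of nome `q`. -/
noncomputable def coeff (q : ℝ) (j : ℕ) : ℝ := (1 - q) * (q ^ j / (1 - q ^ (2 * j + 1)))

theorem one_sub_pow_pos {q : ℝ} (hq : q ∈ Ioo (0 : ℝ) 1) (n : ℕ) : 0 < 1 - q ^ (n + 1) :=
  sub_pos.2 (pow_lt_one₀ hq.1.le hq.2 n.succ_ne_zero)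

theorem coeff_pos {q : ℝ} (hq : q ∈ Ioo (0 : ℝ) 1) (j : ℕ) : 0 < coeff q j := by
  have h1 := one_sub_pow_pos hq (2 * j)
  have h2 := sub_pos.2 hq.2
  have := hq.1
  unfold coeff
  positivity

theorem coeff_zero {q : ℝ} (hq : q ∈ Ioo (0 : ℝ) 1) : coeff q 0 = 1 := by
  have h2 := (sub_pos.2 hq.2).ne'
  simp [coeff, h2]

theorem coeff_le_pow {q : ℝ} (hq : q ∈ Ioo (0 : ℝ) 1) (j : ℕ) : coeff q j ≤ q ^ j := by
  have h1 := one_sub_pow_pos hq (2 * j)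
  have h2 : q ^ (2 * j + 1) ≤ q := pow_le_of_le_one hq.1.le hq.2.le (by omega)
  have h3 := pow_pos hq.1 j
  rw [coeff, mul_div_assoc', div_le_iff₀ h1, mul_comm]
  gcongr

theorem summable_coeff {q : ℝ} (hq : q ∈ Ioo (0 : ℝ) 1) : Summable (coeff q) :=
  (summable_geometric_of_lt_one hq.1.le hq.2).of_nonneg_of_le
    (fun j => (coeff_pos hq j).le) (coeff_le_pow hq)

/-- `(coeff q j)⁻¹` is the symmetric sum `q^(-j) + ... + q^j`; passing to `j + 1` adds its two end
terms. Since `x + x⁻¹` decreases on `(0, 1)`, monotonicity in `q` follows. -/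
theorem inv_coeff_succ {q : ℝ} (hq : q ∈ Ioo (0 : ℝ) 1) (j : ℕ) :
    (coeff q (j + 1))⁻¹ = (coeff q j)⁻¹ + (q ^ (j + 1) + (q ^ (j + 1))⁻¹) := by
  have h2 := (sub_pos.2 hq.2).ne'
  have h3 := hq.1.ne'
  have h1 := (one_sub_pow_pos hq (2 * j)).ne'
  have h4 := (one_sub_pow_pos hq (2 * (j + 1))).ne'
  simp only [coeff, mul_inv, inv_div]
  field_simp
  ring

theorem add_inv_lt_add_inv {x y : ℝ} (hx : 0 < x) (hxy : x < y) (hy : y < 1) :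
    y + y⁻¹ < x + x⁻¹ := by
  have hy0 := hx.trans hxy
  have h : x + x⁻¹ - (y + y⁻¹) = (y - x) * (1 - x * y) / (x * y) := by field_simp; ring
  have h1 : x * y < 1 := by nlinarith
  have : 0 < x + x⁻¹ - (y + y⁻¹) := by
    rw [h]
    exact div_pos (mul_pos (sub_pos.2 hxy) (sub_pos.2 h1)) (mul_pos hx hy0)
  linarith

theorem coeff_le_coeff {q p : ℝ} (hq : q ∈ Ioo (0 : ℝ) 1) (hp : p ∈ Ioo (0 : ℝ) 1) (h : q < p)
    (j : ℕ) : coeff q j ≤ coeff p j ∧ coeff q (j + 1) < coeff p (j + 1) := by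
  have key : ∀ j, (coeff p j)⁻¹ ≤ (coeff q j)⁻¹ ∧ (coeff p (j + 1))⁻¹ < (coeff q (j + 1))⁻¹ := by
    have step : ∀ j, (coeff p j)⁻¹ ≤ (coeff q j)⁻¹ →
        (coeff p (j + 1))⁻¹ < (coeff q (j + 1))⁻¹ := fun j hj => by
      rw [inv_coeff_succ hq, inv_coeff_succ hp]
      exact add_lt_add_of_le_of_lt hj (add_inv_lt_add_inv (pow_pos hq.1 _)
        (pow_lt_pow_left₀ h hq.1.le j.succ_ne_zero) (pow_lt_one₀ hp.1.le hp.2 j.succ_ne_zero))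
    intro j
    induction j with
    | zero =>
      have : (coeff p 0)⁻¹ ≤ (coeff q 0)⁻¹ := by rw [coeff_zero hq, coeff_zero hp]
      exact ⟨this, step _ this⟩
    | succ j ih => exact ⟨ih.2.le, step _ ih.2.le⟩
  exact ⟨(inv_le_inv₀ (coeff_pos hp _) (coeff_pos hq _)).1 (key j).1,
    (inv_lt_inv₀ (coeff_pos hp _) (coeff_pos hq _)).1 (key j).2⟩

theorem tsum_coeff_succ_lt {q p : ℝ} (hq : q ∈ Ioo (0 : ℝ) 1) (hp : p ∈ Ioo (0 : ℝ) 1)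
    (h : q < p) : ∑' j, coeff q (j + 1) < ∑' j, coeff p (j + 1) :=
  Summable.tsum_lt_tsum (i := 0) (fun j => (coeff_le_coeff hq hp h j).2.le)
    (coeff_le_coeff hq hp h 0).2 ((summable_nat_add_iff 1).2 (summable_coeff hq))
    ((summable_nat_add_iff 1).2 (summable_coeff hp))

theorem summable_pow_div_one_sub_pow {b : ℝ} (hb : b ∈ Ioo (0 : ℝ) 1) {k : ℕ} (hk : k ≠ 0) :
    Summable fun n : ℕ => b ^ (n + 1) / (1 - (b ^ k) ^ (n + 1)) := by
  have hbk : b ^ k ∈ Ioo (0 : ℝ) 1 := ⟨pow_pos hb.1 k, pow_lt_one₀ hb.1.le hb.2 hk⟩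
  have h1 := sub_pos.2 hbk.2
  have h := ((summable_nat_add_iff 1).2 (summable_geometric_of_lt_one hb.1.le hb.2)).mul_right
    (1 - b ^ k)⁻¹
  refine h.of_nonneg_of_le (fun n => div_nonneg (pow_pos hb.1 _).le (one_sub_pow_pos hbk n).le)
    fun n => ?_
  rw [← div_eq_mul_inv]
  have h2 : (b ^ k) ^ (n + 1) ≤ b ^ k := pow_le_of_le_one hbk.1.le hbk.2.le (by omega)
  have := pow_pos hb.1 (n + 1)
  gcongr

/-- Termwise this is `x / (1 - x) - x² / (1 - x²) = x / (1 - x²)`. -/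
theorem lambert_sub_lambert_sq {b : ℝ} (hb : b ∈ Ioo (0 : ℝ) 1) :
    lambert b - lambert (b ^ 2) = ∑' n : ℕ, b ^ (n + 1) / (1 - (b ^ 2) ^ (n + 1)) := by
  have hb2 : b ^ 2 ∈ Ioo (0 : ℝ) 1 := ⟨pow_pos hb.1 2, pow_lt_one₀ hb.1.le hb.2 two_ne_zero⟩
  have h1 := summable_pow_div_one_sub_pow hb one_ne_zero
  have h2 := summable_pow_div_one_sub_pow hb2 one_ne_zero
  simp only [pow_one] at h1 h2
  unfold lambert
  rw [← h1.tsum_sub h2]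
  refine tsum_congr fun n => ?_
  have h3 := (one_sub_pow_pos hb n).ne'
  have h4 : 1 - b ^ (n + 1) * b ^ (n + 1) ≠ 0 := by
    have := (one_sub_pow_pos hb2 n).ne'
    rwa [← pow_mul, mul_comm 2, pow_mul, sq] at this
  rw [← pow_mul, mul_comm 2, pow_mul, sq]
  generalize b ^ (n + 1) = x at h3 h4 ⊢
  rw [div_sub_div _ _ h3 h4, div_eq_div_iff (mul_ne_zero h3 h4) h4]
  ring

/-- The left side is a difference of two sums of the previous kind, at `b` and `b²`; the second is
the even-exponent part of the first. -/
theorem lambert_comb_eq_tsum {b : ℝ} (hb : b ∈ Ioo (0 : ℝ) 1) :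
    lambert b - 2 * lambert (b ^ 2) + lambert ((b ^ 2) ^ 2) =
      ∑' j : ℕ, b ^ (2 * j + 1) / (1 - (b ^ 2) ^ (2 * j + 1)) := by
  have hb2 : b ^ 2 ∈ Ioo (0 : ℝ) 1 := ⟨pow_pos hb.1 2, pow_lt_one₀ hb.1.le hb.2 two_ne_zero⟩
  have h1 := lambert_sub_lambert_sq hb
  have h2 := lambert_sub_lambert_sq hb2
  have hs := summable_pow_div_one_sub_pow hb two_ne_zero
  have hi : Function.Injective fun k : ℕ => 2 * k := fun a b h => by simpa using h
  have hi' : Function.Injective fun k : ℕ => 2 * k + 1 := fun a b h => by simpa using h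
  rw [← tsum_even_add_odd (f := fun n : ℕ => b ^ (n + 1) / (1 - (b ^ 2) ^ (n + 1)))
    (hs.comp_injective hi) (hs.comp_injective hi')] at h1
  have e : ∑' k : ℕ, b ^ (2 * k + 1 + 1) / (1 - (b ^ 2) ^ (2 * k + 1 + 1)) =
      ∑' n : ℕ, (b ^ 2) ^ (n + 1) / (1 - ((b ^ 2) ^ 2) ^ (n + 1)) := by
    refine tsum_congr fun n => ?_
    rw [show 2 * n + 1 + 1 = 2 * (n + 1) by ring, pow_mul, pow_mul]
  rw [e, ← h2] at h1
  linarith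

theorem tsum_coeff_eq_two {q : ℝ} (hq : q ∈ Ioo (0 : ℝ) 1)
    (h : (lambert (√q) - 2 * lambert q + lambert (q ^ 2)) / √q = 2 / (1 - q)) :
    ∑' j, coeff q j = 2 := by
  have hb : √q ∈ Ioo (0 : ℝ) 1 := ⟨sqrt_pos.2 hq.1, by rw [sqrt_lt' one_pos]; linarith [hq.2]⟩
  have h1 := lambert_comb_eq_tsum hb
  have hsq : √q ^ 2 = q := sq_sqrt hq.1.le
  have h2 := sub_pos.2 hq.2
  rw [hsq] at h1
  rw [h1, ← tsum_div_const] at h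
  have e : ∀ j : ℕ, √q ^ (2 * j + 1) / (1 - q ^ (2 * j + 1)) / √q =
      q ^ j / (1 - q ^ (2 * j + 1)) := fun j => by
    have := hb.1.ne'
    rw [pow_succ, pow_mul, hsq]
    field_simp
  simp only [e] at h
  simp only [coeff]
  rw [tsum_mul_left, h]
  field_simp

theorem tsum_coeff_succ_eq_one {q : ℝ} (hq : q ∈ Ioo (0 : ℝ) 1) (h : ∑' j, coeff q j = 2) :
    ∑' j, coeff q (j + 1) = 1 := by
  have := (summable_coeff hq).tsum_eq_zero_add
  rw [h, coeff_zero hq] at this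
  linarith

/-- Replacing each `1 - q^(2j+3)` by `1 - q³` leaves a geometric series, and `1 ≤ q / (1 - q³)`. -/
theorem one_le_pow_three_add {q : ℝ} (hq : q ∈ Ioo (0 : ℝ) 1) (h : ∑' j, coeff q j = 2) :
    1 ≤ q ^ 3 + q := by
  have h3 : 0 < 1 - q ^ 3 := one_sub_pow_pos hq 2
  have hq1 := sub_pos.2 hq.2
  have hle : ∀ j, coeff q (j + 1) ≤ (1 - q) * q / (1 - q ^ 3) * q ^ j := fun j => by
    have h2 : q ^ (2 * (j + 1) + 1) ≤ q ^ 3 := pow_le_pow_of_le_one hq.1.le hq.2.le (by omega)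
    have := pow_pos hq.1 (j + 1)
    calc coeff q (j + 1) ≤ (1 - q) * (q ^ (j + 1) / (1 - q ^ 3)) := by unfold coeff; gcongr
      _ = _ := by ring
  have hg := summable_geometric_of_lt_one hq.1.le hq.2
  have := ((summable_nat_add_iff 1).2 (summable_coeff hq)).tsum_le_tsum hle (hg.mul_left _)
  rw [tsum_coeff_succ_eq_one hq h, tsum_mul_left, tsum_geometric_of_lt_one hq.1.le hq.2] at this
  have e : (1 - q) * q / (1 - q ^ 3) * (1 - q)⁻¹ = q / (1 - q ^ 3) := by field_simp
  rw [e, le_div_iff₀ h3] at this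
  linarith

theorem neg_log_le {q : ℝ} (hq : q ∈ Ioo (0 : ℝ) 1) (h : 1 ≤ q ^ 3 + q) : -log q ≤ 2 / 5 := by
  -- `50/74` is the inverse of `1 + x + x²/2` at `x = 2/5`, a lower bound for `exp x`.
  have h1 : (50 : ℝ) / 74 ≤ q := by
    by_contra! hlt
    have : q ^ 3 ≤ (50 / 74) ^ 3 := pow_le_pow_left₀ hq.1.le hlt.le 3
    norm_num at this
    linarith
  have h2 := quadratic_le_exp_of_nonneg (x := 2 / 5) (by norm_num)
  rw [neg_le, le_log_iff_exp_le hq.1, exp_neg]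
  refine le_trans ?_ h1
  rw [inv_le_comm₀ (exp_pos _) (by norm_num)]
  norm_num at h2 ⊢
  linarith

/-- For a modulus `k` with complement `k'`, `1 - k ≤ 1 - k² = k'²`, and `k'` is exponentially small
in `1/t`. -/
theorem one_sub_thetaModulus_lt {t : ℝ} (ht : 0 < t) (h : π * t ≤ 2 / 5) :
    1 - thetaModulus t < 1 / 10 ^ 7 := by
  have hi : 0 < 1 / t := by positivity
  have hpi : 24.6 ≤ π * (1 / t) := by
    rw [mul_one_div, le_div_iff₀ ht]
    have : π * (π * t) ≤ π * (2 / 5) := by gcongr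
    nlinarith [pi_gt_d2]
  have ht1 : 1 ≤ 1 / t := by
    have : 1 ≤ π * (1 / t) / π := by
      rw [le_div_iff₀ pi_pos]; linarith [pi_lt_four]
    rwa [mul_div_cancel_left₀ _ pi_ne_zero] at this
  have hk := thetaModulus_mem_Ico ht
  have h1 : 1 - thetaModulus t ≤ thetaModulus (1 / t) ^ 2 := by
    have := sq_thetaModulus_add_sq_thetaModulus_inv ht
    nlinarith [hk.1, hk.2]
  have h2 : thetaModulus (1 / t) ≤ gaussSum (1 / 2) (1 / t) ^ 2 :=
    div_le_self (sq_nonneg _) (one_le_pow₀ (one_le_gaussSum_zero hi))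
  -- `21` is a safe lower bound for `π/t - π`, which is at least `24.6 - 3.15`.
  have h3 : gaussSum (1 / 2) (1 / t) ≤ exp (-(21 / 4)) * 3 := by
    refine (gaussSum_half_le ht1).trans ?_
    have := (gaussSum_pos (1 / 2) one_pos).le
    have := gaussSum_half_one_le
    have : -π * (1 / t - 1) / 4 ≤ -(21 / 4) := by linarith [pi_lt_d2]
    gcongr
  have h4 := (gaussSum_pos (1 / 2) hi).le
  have he : exp (-21) ≤ (2.71 ^ 21)⁻¹ := by
    have := exp_one_gt_d9
    rw [exp_neg, inv_le_inv₀ (exp_pos _) (by positivity),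
      show (21 : ℝ) = (21 : ℕ) * 1 by norm_num, exp_nat_mul]
    gcongr
    linarith
  calc 1 - thetaModulus t ≤ thetaModulus (1 / t) ^ 2 := h1
    _ ≤ (gaussSum (1 / 2) (1 / t) ^ 2) ^ 2 := by
      have := (thetaModulus_pos hi).le
      gcongr
    _ ≤ ((exp (-(21 / 4)) * 3) ^ 2) ^ 2 := by gcongr
    _ = 81 * exp (-21) := by
      rw [← pow_mul, mul_pow, ← exp_nat_mul]
      norm_num
      ring
    _ ≤ 81 * (2.71 ^ 21)⁻¹ := by gcongr
    _ < 1 / 10 ^ 7 := by norm_num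

end JacobiBasis

/-! ### A Riesz basis criterion by perturbation of an orthonormal basis. -/

namespace JacobiBasis

open Real Filter Topology Set

section Operator

variable {ι 𝕜 H : Type*} [RCLike 𝕜] [NormedAddCommGroup H] [InnerProductSpace 𝕜 H] [CompleteSpace H]

/-- A weighted shift `e_i ↦ a_i e_{φ i}` along an injection is bounded by `sup |a_i|`. -/
theorem exists_weightedShift (b : HilbertBasis ι 𝕜 H) {φ : ι → ι} (hφ : Function.Injective φ)
    (a : ι → ℝ) {K : ℝ} (hK : 0 ≤ K) (ha : ∀ i, |a i| ≤ K) :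
    ∃ T : H →L[𝕜] H, ‖T‖ ≤ K ∧ ∀ i, T (b i) = (a i : 𝕜) • b (φ i) := by
  classical
  have hb : Orthonormal 𝕜 (b ∘ φ) := b.orthonormal.comp φ hφ
  have hn : ∀ i, ‖(a i : 𝕜) • ContinuousLinearMap.id 𝕜 𝕜‖ ≤ K := fun i => by
    rw [norm_smul, ContinuousLinearMap.norm_id, mul_one, RCLike.norm_ofReal]
    exact ha i
  -- Factor the shift as coordinates, a diagonal operator on `ℓ²`, and the isometry onto the
  -- orthonormal family `b ∘ φ`.
  let D := lp.mapCLM 2 (fun i => (a i : 𝕜) • ContinuousLinearMap.id 𝕜 𝕜) hK hn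
  let V := hb.orthogonalFamily.linearIsometry
  refine ⟨V.toContinuousLinearMap ∘L D ∘L
    (b.repr.toContinuousLinearEquiv : H →L[𝕜] lp (fun _ : ι => 𝕜) 2), ?_, fun i => ?_⟩
  · refine ContinuousLinearMap.opNorm_le_bound _ hK fun x => ?_
    simp only [ContinuousLinearMap.comp_apply, LinearIsometry.coe_toContinuousLinearMap,
      LinearIsometry.norm_map]
    refine (D.le_of_opNorm_le (lp.norm_mapCLM_le _ _ hK hn) _).trans_eq ?_
    congr 1
    exact b.repr.norm_map x
  · have h1 : D (lp.single 2 i (1 : 𝕜)) = lp.single 2 i (a i : 𝕜) := by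
      ext j
      simp only [D, lp.mapCLM_apply_coe, lp.single_apply]
      rcases eq_or_ne j i with rfl | h
      · simp
      · simp [h]
    simp only [ContinuousLinearMap.comp_apply, LinearIsometry.coe_toContinuousLinearMap]
    change V (D (b.repr (b i))) = _
    rw [b.repr_self, h1]
    simp [V]

/-- A family `f_i = ∑_j a_{j,i} e_{φ_j i}` with `φ_0 = id`, `a_0 = 1` is a Riesz basis when the
remaining coefficients are dominated by a sequence with sum less than one. -/
theorem isRieszBasis_of_hasSum (b : HilbertBasis ι 𝕜 H) {φ : ℕ → ι → ι}
    (hφ : ∀ j, Function.Injective (φ j)) (hφ0 : ∀ i, φ 0 i = i) {a : ℕ → ι → ℝ}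
    (ha0 : ∀ i, a 0 i = 1) {d : ℕ → ℝ} (hd : Summable d) (had : ∀ j i, |a (j + 1) i| ≤ d j)
    (hd0 : ∀ j, 0 ≤ d j) (hd1 : ∑' j, d j < 1) {f : ι → H}
    (hf : ∀ i, HasSum (fun j => (a j i : 𝕜) • b (φ j i)) (f i)) : IsRieszBasis 𝕜 f := by
  choose T hT hTb using fun j => exists_weightedShift b (hφ (j + 1)) (a (j + 1)) (hd0 j) (had j)
  have hs : Summable T := Summable.of_norm_bounded hd hT
  have hnorm : ‖-∑' j, T j‖ < 1 := by
    rw [norm_neg]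
    exact (tsum_of_norm_bounded hd.hasSum hT).trans_lt hd1
  -- The operator is `1 + ∑ T j`, a unit by the Neumann series; the `1` accounts for the term `j =
  -- 0`.
  refine ⟨b, ContinuousLinearEquiv.unitsEquiv 𝕜 H (Units.oneSub _ hnorm), fun i => ?_⟩
  rw [ContinuousLinearEquiv.unitsEquiv_apply, Units.val_oneSub, sub_neg_eq_add]
  change b i + (∑' j, T j) (b i) = f i
  have h1 : HasSum (fun j => T j (b i)) ((∑' j, T j) (b i)) :=
    hs.hasSum.mapL (ContinuousLinearMap.apply 𝕜 H (b i))
  have h2 := (hasSum_nat_add_iff' (f := fun j => (a j i : 𝕜) • b (φ j i)) 1).2 (hf i)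
  simp only [hTb] at h1
  have h3 := h1.unique h2
  rw [h3]
  simp [ha0, hφ0]

end Operator

end JacobiBasis

/-! ### The sine basis of `L²(0, 1)` and the expansion of `g`. -/

namespace JacobiBasis

open Real Filter Topology Set MeasureTheory

theorem integral_cos_int_mul_pi (k : ℤ) :
    ∫ x in Ioo (0 : ℝ) 1, cos (k * π * x) = if k = 0 then 1 else 0 := by
  rw [← integral_Ioc_eq_integral_Ioo, ← intervalIntegral.integral_of_le zero_le_one]
  split_ifs with h
  · simp [h]
  · have hk : (k : ℝ) * π ≠ 0 := mul_ne_zero (Int.cast_ne_zero.2 h) pi_ne_zero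
    rw [intervalIntegral.integral_comp_mul_left (fun x => cos x) hk]
    simp [sin_int_mul_pi]

theorem continuous_sineFun (k : ℕ) : Continuous (sineFun k) := by
  unfold sineFun
  fun_prop

theorem abs_sineFun_le (k : ℕ) (x : ℝ) : |sineFun k x| ≤ √2 := by
  rw [sineFun, abs_mul, abs_of_nonneg (sqrt_nonneg 2)]
  exact mul_le_of_le_one_right (sqrt_nonneg 2) (abs_sin_le_one _)

theorem integral_sineFun_mul_sineFun {m n : ℕ} (hm : m ≠ 0) :
    ∫ x in Ioo (0 : ℝ) 1, sineFun m x * sineFun n x = if m = n then 1 else 0 := by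
  have e : ∀ x, sineFun m x * sineFun n x =
      cos (((m - n : ℤ) : ℝ) * π * x) - cos (((m + n : ℤ) : ℝ) * π * x) := fun x => by
    have h2 : √2 * √2 = 2 := mul_self_sqrt (by norm_num)
    push_cast
    rw [sub_mul, sub_mul, add_mul, add_mul, cos_sub, cos_add, sineFun, sineFun]
    linear_combination (sin (m * π * x) * sin (n * π * x)) * h2
  have hi : ∀ k : ℤ, IntegrableOn (fun x : ℝ => cos (k * π * x)) (Ioo 0 1) := fun k =>
    (Continuous.integrableOn_Icc (by fun_prop)).mono_set Ioo_subset_Icc_self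
  simp_rw [e]
  rw [integral_sub (hi _) (hi _), integral_cos_int_mul_pi, integral_cos_int_mul_pi,
    if_neg (c := ((m : ℤ) + n = 0)) (by omega), sub_zero]
  exact if_congr (by omega) rfl rfl

section Completeness

variable {E : Type*} [NormedAddCommGroup E] [NormedSpace ℝ E]

theorem integrable_bdd_smul {μ : Measure ℝ} {u : ℝ → E} (hu : Integrable u μ) {h : ℝ → ℝ}
    (hc : Continuous h) {C : ℝ} (hb : ∀ x, |h x| ≤ C) : Integrable (fun x => h x • u x) μ :=
  hu.bdd_smul C hc.aestronglyMeasurable (Eventually.of_forall hb)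

/-- Induction on the power of the cosine, through `2 sin(kθ) cos θ = sin((k+1)θ) + sin((k-1)θ)`;
frequency 0 contributes nothing. -/
theorem integral_sin_mul_cos_pow_smul {μ : Measure ℝ} {u : ℝ → E} (hu : Integrable u μ)
    (h : ∀ k : ℕ, k ≠ 0 → ∫ x, sin (k * π * x) • u x ∂μ = 0) (m k : ℕ) :
    ∫ x, (sin (k * π * x) * cos (π * x) ^ m) • u x ∂μ = 0 := by
  induction m generalizing k with
  | zero =>
    rcases eq_or_ne k 0 with rfl | hk
    · simp
    · simpa using h k hk
  | succ m ih =>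
    rcases k with _ | k
    · simp
    have hi : ∀ k : ℕ, Integrable (fun x => (sin (k * π * x) * cos (π * x) ^ m) • u x) μ := fun k =>
      integrable_bdd_smul hu (by fun_prop) (C := 1) fun x => by
        rw [abs_mul, abs_pow]
        exact mul_le_one₀ (abs_sin_le_one _) (by positivity)
          (pow_le_one₀ (abs_nonneg _) (abs_cos_le_one _))
    have e : ∀ x, (sin ((k + 1 : ℕ) * π * x) * cos (π * x) ^ (m + 1)) • u x =
        (1 / 2 : ℝ) • ((sin ((k + 2 : ℕ) * π * x) * cos (π * x) ^ m) • u x +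
          (sin (k * π * x) * cos (π * x) ^ m) • u x) := fun x => by
      rw [← add_smul, smul_smul]
      congr 1
      have e1 : ((k + 2 : ℕ) : ℝ) * π * x = (k + 1 : ℕ) * π * x + π * x := by push_cast; ring
      have e2 : (k : ℝ) * π * x = (k + 1 : ℕ) * π * x - π * x := by push_cast; ring
      rw [e1, e2, sin_add, sin_sub]
      ring
    simp_rw [e]
    rw [integral_smul, integral_add (hi _) (hi _), ih, ih]
    simp

theorem integral_sin_mul_polynomial_smul {μ : Measure ℝ} {u : ℝ → E} (hu : Integrable u μ)
    (h : ∀ k : ℕ, k ≠ 0 → ∫ x, sin (k * π * x) • u x ∂μ = 0) (p : Polynomial ℝ) :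
    ∫ x, p.eval (cos (π * x)) • sin (π * x) • u x ∂μ = 0 := by
  have hi : ∀ m : ℕ, Integrable (fun x => (sin (π * x) * cos (π * x) ^ m) • u x) μ := fun m =>
    integrable_bdd_smul hu (by fun_prop) (C := 1) fun x => by
      rw [abs_mul, abs_pow]
      exact mul_le_one₀ (abs_sin_le_one _) (by positivity)
        (pow_le_one₀ (abs_nonneg _) (abs_cos_le_one _))
  have e : ∀ x, p.eval (cos (π * x)) • sin (π * x) • u x =
      ∑ m ∈ p.support, p.coeff m • (sin (π * x) * cos (π * x) ^ m) • u x := fun x => by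
    rw [Polynomial.eval_eq_sum, Polynomial.sum, Finset.sum_smul]
    refine Finset.sum_congr rfl fun m _ => ?_
    rw [smul_smul, smul_smul]
    congr 1
    ring
  simp_rw [e]
  rw [integral_finsetSum _ fun m _ => Integrable.fun_smul (p.coeff m) (hi m)]
  refine Finset.sum_eq_zero fun m _ => ?_
  rw [integral_smul]
  have := integral_sin_mul_cos_pow_smul hu h m 1
  simp only [Nat.cast_one, one_mul] at this
  rw [this, smul_zero]

/-- The sine system is complete: an integrable function on `(0, 1)` whose sine coefficients all
vanish is zero almost everywhere. -/
theorem ae_eq_zero_of_integral_sin_smul [CompleteSpace E] {u : ℝ → E}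
    (hu : IntegrableOn u (Ioo 0 1))
    (h : ∀ k : ℕ, k ≠ 0 → ∫ x in Ioo (0 : ℝ) 1, sin (k * π * x) • u x = 0) :
    u =ᵐ[volume.restrict (Ioo 0 1)] 0 := by
  set v : ℝ → E := fun x => sin (π * x) • u x with hv
  have hvi : IntegrableOn v (Ioo 0 1) :=
    integrable_bdd_smul hu (by fun_prop) fun x => abs_sin_le_one _
  have key : ∀ f : ℝ → ℝ, Continuous f → ∫ x in Ioo (0 : ℝ) 1, f x • v x = 0 := by
    intro f hf
    have hfv : IntegrableOn (fun x => f x • v x) (Ioo 0 1) := by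
      obtain ⟨C, hC⟩ := isCompact_Icc.exists_bound_of_continuousOn (hf.continuousOn (s := Icc 0 1))
      refine hvi.bdd_smul C hf.aestronglyMeasurable ?_
      filter_upwards [ae_restrict_mem measurableSet_Ioo] with x hx using hC x (Ioo_subset_Icc_self hx)
    have hbound : ∀ ε > 0, ‖∫ x in Ioo (0 : ℝ) 1, f x • v x‖ ≤
        ε * ∫ x in Ioo (0 : ℝ) 1, ‖v x‖ := fun ε hε => by
      -- `x ↦ cos (π x)` maps `[0, 1]` bijectively onto `[-1, 1]`, so Weierstrass approximates `f`
      -- by polynomials in `cos (π x)`.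
      obtain ⟨p, hp⟩ := exists_polynomial_near_of_continuousOn (-1) 1
        (fun y => f (arccos y / π)) (by fun_prop) ε hε
      have h0 := integral_sin_mul_polynomial_smul hu h p
      have hpv : IntegrableOn (fun x => p.eval (cos (π * x)) • v x) (Ioo 0 1) := by
        obtain ⟨C, hC⟩ := isCompact_Icc.exists_bound_of_continuousOn
          (p.continuous.continuousOn (s := Icc (-1) 1))
        refine integrable_bdd_smul hvi (by fun_prop) (C := C) fun x => ?_
        exact hC _ ⟨neg_one_le_cos _, cos_le_one _⟩
      rw [← sub_zero (∫ x in Ioo (0 : ℝ) 1, f x • v x), ← h0, ← integral_sub hfv hpv,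
        ← integral_const_mul]
      refine norm_integral_le_of_norm_le (hvi.norm.const_mul ε) ?_
      filter_upwards [ae_restrict_mem measurableSet_Ioo] with x hx
      have h1 := hp (cos (π * x)) ⟨neg_one_le_cos _, cos_le_one _⟩
      have h2 : arccos (cos (π * x)) = π * x :=
        arccos_cos (mul_nonneg pi_pos.le hx.1.le) (mul_le_of_le_one_right pi_pos.le hx.2.le)
      rw [h2, mul_div_cancel_left₀ _ pi_ne_zero, abs_sub_comm] at h1
      change ‖f x • v x - _ • v x‖ ≤ _
      rw [← sub_smul, norm_smul]
      exact mul_le_mul_of_nonneg_right h1.le (norm_nonneg _)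
    have ht : Tendsto (fun ε : ℝ => ε * ∫ x in Ioo (0 : ℝ) 1, ‖v x‖) (𝓝[>] 0) (𝓝 0) := by
      have : Tendsto (fun ε : ℝ => ε * ∫ x in Ioo (0 : ℝ) 1, ‖v x‖) (𝓝 0)
          (𝓝 (0 * ∫ x in Ioo (0 : ℝ) 1, ‖v x‖)) := tendsto_id.mul_const _
      rw [zero_mul] at this
      exact this.mono_left nhdsWithin_le_nhds
    exact norm_le_zero_iff.1 (ge_of_tendsto ht (eventually_mem_nhdsWithin.mono hbound))
  have hz := isOpen_Ioo.ae_eq_zero_of_integral_contDiff_smul_eq_zero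
    hvi.locallyIntegrableOn fun f hf _ hs => by
      rw [← key f hf.continuous, setIntegral_eq_integral_of_forall_compl_eq_zero]
      intro x hx
      rw [image_eq_zero_of_notMem_tsupport (fun hx' => hx (hs hx')), zero_smul]
  rw [EventuallyEq, ae_restrict_iff' measurableSet_Ioo]
  filter_upwards [hz] with x hx hx'
  -- What vanishes so far is `sin (π x) • u x`; the sine has no zero inside the interval.
  have hsin : sin (π * x) ≠ 0 :=
    (sin_pos_of_pos_of_lt_pi (mul_pos pi_pos hx'.1) (mul_lt_of_lt_one_right pi_pos hx'.2)).ne'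
  exact (smul_eq_zero.1 (hx hx')).resolve_left hsin

end Completeness

section SineBasis

variable (𝕜 : Type*) [RCLike 𝕜]

/-- The function `e_k` as a bounded continuous function. -/
noncomputable def sineBCF (k : ℕ) : BoundedContinuousFunction ℝ 𝕜 :=
  BoundedContinuousFunction.ofNormedAddCommGroup (fun x => ((sineFun k x : ℝ) : 𝕜))
    (RCLike.continuous_ofReal.comp (continuous_sineFun k)) √2
    fun x => by rw [RCLike.norm_ofReal]; exact abs_sineFun_le k x

theorem norm_sineBCF_le (k : ℕ) : ‖sineBCF 𝕜 k‖ ≤ √2 :=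
  BoundedContinuousFunction.norm_ofNormedAddCommGroup_le _ (sqrt_nonneg 2) _

/-- Bounded continuous functions as elements of `L²(0, 1)`. -/
noncomputable def toL2 : BoundedContinuousFunction ℝ 𝕜 →L[𝕜]
    Lp 𝕜 2 (volume.restrict (Ioo (0 : ℝ) 1)) :=
  BoundedContinuousFunction.toLp 2 _ 𝕜

theorem toL2_ae_eq (f : BoundedContinuousFunction ℝ 𝕜) :
    toL2 𝕜 f =ᵐ[volume.restrict (Ioo (0 : ℝ) 1)] f :=
  BoundedContinuousFunction.coeFn_toLp 2 _ 𝕜 f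

theorem inner_toL2_sineBCF (k : ℕ) (u : Lp 𝕜 2 (volume.restrict (Ioo (0 : ℝ) 1))) :
    inner 𝕜 (toL2 𝕜 (sineBCF 𝕜 k)) u = ∫ x in Ioo (0 : ℝ) 1, sineFun k x • u x := by
  rw [L2.inner_def]
  refine integral_congr_ae ?_
  filter_upwards [toL2_ae_eq 𝕜 (sineBCF 𝕜 k)] with x hx
  rw [hx, RCLike.inner_apply, RCLike.real_smul_eq_coe_mul, mul_comm]
  simp [sineBCF]

theorem orthonormal_sine : Orthonormal 𝕜 fun n : ℕ+ => toL2 𝕜 (sineBCF 𝕜 n) := by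
  classical
  rw [orthonormal_iff_ite]
  intro m n
  rw [inner_toL2_sineBCF]
  have : ∫ x in Ioo (0 : ℝ) 1, sineFun m x • (toL2 𝕜 (sineBCF 𝕜 n)) x =
      ∫ x in Ioo (0 : ℝ) 1, ((sineFun m x * sineFun n x : ℝ) : 𝕜) := by
    refine integral_congr_ae ?_
    filter_upwards [toL2_ae_eq 𝕜 (sineBCF 𝕜 n)] with x hx
    rw [hx, RCLike.real_smul_eq_coe_mul]
    simp [sineBCF]
  rw [this, integral_ofReal, integral_sineFun_mul_sineFun m.ne_zero]
  simp [apply_ite]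

theorem orthogonal_span_sine :
    (Submodule.span 𝕜 (range fun n : ℕ+ => toL2 𝕜 (sineBCF 𝕜 n)))ᗮ = ⊥ := by
  rw [eq_bot_iff]
  intro u hu
  rw [Submodule.mem_bot, Lp.eq_zero_iff_ae_eq_zero]
  have hui : IntegrableOn u (Ioo 0 1) := (Lp.memLp u).integrable (by norm_num)
  refine ae_eq_zero_of_integral_sin_smul hui fun k hk => ?_
  have h := (Submodule.mem_orthogonal _ _).1 hu _
    (Submodule.subset_span ⟨⟨k, Nat.pos_of_ne_zero hk⟩, rfl⟩)
  simp only [PNat.mk_coe, inner_toL2_sineBCF, sineFun, mul_smul] at h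
  rw [integral_smul] at h
  exact (smul_eq_zero.1 h).resolve_left (by positivity)

/-- The orthonormal basis `e_n(x) = √2 sin(nπx)`, `n ≥ 1`, of `L²(0, 1)`. -/
noncomputable def sineBasis : HilbertBasis ℕ+ 𝕜 (Lp 𝕜 2 (volume.restrict (Ioo (0 : ℝ) 1))) :=
  HilbertBasis.mkOfOrthogonalEqBot (orthonormal_sine 𝕜) (orthogonal_span_sine 𝕜)

theorem sineBasis_apply (n : ℕ+) : sineBasis 𝕜 n = toL2 𝕜 (sineBCF 𝕜 n) := by
  rw [sineBasis, HilbertBasis.coe_mkOfOrthogonalEqBot]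

/-- Multiplication of an index by the odd number `2j + 1`. -/
def oddMul (j : ℕ) (n : ℕ+) : ℕ+ := ⟨n * (2 * j + 1), by positivity⟩

theorem oddMul_injective (j : ℕ) : Function.Injective (oddMul j) := fun m n h => by
  have h' : (m : ℕ) * (2 * j + 1) = n * (2 * j + 1) := congrArg PNat.val h
  exact PNat.coe_injective (Nat.eq_of_mul_eq_mul_right (by omega) h')

/-- The expansion of `g(n ·, μ)` in the sine basis. -/
theorem exists_hasSum_g (n : ℕ+) {μ : ℝ} (hμ : μ ∈ Ioo (0 : ℝ) 1) :
    ∃ f : Lp 𝕜 2 (volume.restrict (Ioo (0 : ℝ) 1)),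
      (f =ᵐ[volume.restrict (Ioo (0 : ℝ) 1)] fun x : ℝ => ((g ((n : ℕ) * x) μ : ℝ) : 𝕜)) ∧
      HasSum (fun j => ((coeff (nome μ) j : ℝ) : 𝕜) • sineBasis 𝕜 (oddMul j n)) f := by
  have hq := nome_mem_Ioo hμ
  -- Convergence in the sup norm identifies the pointwise series for `g`, and continuity of `toL2`
  -- carries the same series to `L²`.
  have hs : Summable fun j => ((coeff (nome μ) j : ℝ) : 𝕜) • sineBCF 𝕜 (oddMul j n) := by
    refine Summable.of_norm_bounded ((summable_coeff hq).mul_right √2) fun j => ?_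
    rw [norm_smul, RCLike.norm_ofReal, abs_of_pos (coeff_pos hq j)]
    exact mul_le_mul_of_nonneg_left (norm_sineBCF_le 𝕜 _) (coeff_pos hq j).le
  refine ⟨toL2 𝕜 (∑' j, ((coeff (nome μ) j : ℝ) : 𝕜) • sineBCF 𝕜 (oddMul j n)), ?_, ?_⟩
  · refine (toL2_ae_eq 𝕜 _).trans (Eventually.of_forall fun x => ?_)
    have h1 := hs.hasSum.mapL (BoundedContinuousFunction.evalCLM 𝕜 x)
    rw [← BoundedContinuousFunction.evalCLM_apply 𝕜, ← h1.tsum_eq]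
    simp only [g]
    rw [← tsum_mul_left, RCLike.ofReal_tsum]
    refine tsum_congr fun j => ?_
    simp only [BoundedContinuousFunction.evalCLM_apply, BoundedContinuousFunction.coe_smul,
      smul_eq_mul, ← mul_assoc, RCLike.ofReal_mul, coeff]
    congr 1
    simp [sineBCF, oddMul, sineFun]
    ring_nf
  · have h2 := hs.hasSum.mapL (toL2 𝕜)
    simpa only [map_smul, ← sineBasis_apply] using h2

end SineBasis

end JacobiBasis

/-! ### Assembly of the theorem. -/

theorem mainTheorem2 (𝕜 : Type*) [RCLike 𝕜] (q₀ μ₀ : ℝ) (hq₀ : q₀ ∈ Set.Ioo (0 : ℝ) 1)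
    (hsharp : (JacobiBasis.lambert (√q₀) - 2 * JacobiBasis.lambert q₀
        + JacobiBasis.lambert (q₀ ^ 2)) / √q₀ = 2 / (1 - q₀))
    (hμ₀ : μ₀ = JacobiBasis.theta2 0 q₀ ^ 2 / JacobiBasis.theta3 0 q₀ ^ 2) :
    1 - μ₀ < 1 / 10 ^ 7 ∧
    ∀ μ : ℕ+ → ℝ, (∀ n, μ n ∈ Set.Ioo (0 : ℝ) 1) → (⨆ n, μ n) < μ₀ →
      ∃ f : ℕ+ → MeasureTheory.Lp 𝕜 2 (MeasureTheory.volume.restrict (Set.Ioo (0 : ℝ) 1)),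
        (∀ n, f n =ᵐ[MeasureTheory.volume.restrict (Set.Ioo (0 : ℝ) 1)]
          fun x : ℝ => ((JacobiBasis.g ((n : ℕ) * x) (μ n) : ℝ) : 𝕜)) ∧
        JacobiBasis.IsRieszBasis 𝕜 f := by
  have htwo := JacobiBasis.tsum_coeff_eq_two hq₀ hsharp
  set t : ℝ := -Real.log q₀ / Real.pi with ht_def
  have hπ := Real.pi_pos
  have ht : 0 < t := div_pos (neg_pos.2 (Real.log_neg hq₀.1 hq₀.2)) hπ
  have hπt : Real.pi * t = -Real.log q₀ := mul_div_cancel₀ _ hπ.ne'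
  have hq : q₀ = Real.exp (-Real.pi * t) := by
    rw [neg_mul, hπt, neg_neg, Real.exp_log hq₀.1]
  have hμ : μ₀ = JacobiBasis.thetaModulus t := by
    rw [hμ₀, hq, JacobiBasis.theta2_zero_eq, JacobiBasis.theta3_zero_eq, JacobiBasis.thetaModulus]
  have hμ₀' : μ₀ ∈ Set.Ioo (0 : ℝ) 1 :=
    hμ ▸ ⟨JacobiBasis.thetaModulus_pos ht, JacobiBasis.thetaModulus_lt_one ht⟩
  refine ⟨hμ ▸ JacobiBasis.one_sub_thetaModulus_lt ht
    (hπt ▸ JacobiBasis.neg_log_le hq₀ (JacobiBasis.one_le_pow_three_add hq₀ htwo)), ?_⟩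
  intro μ hμn hsup
  have hle : ∀ n, μ n ≤ ⨆ n, μ n := le_ciSup ⟨1, by rintro _ ⟨n, rfl⟩; exact (hμn n).2.le⟩
  have hs : (⨆ n, μ n) ∈ Set.Ioo (0 : ℝ) 1 :=
    ⟨(hμn 1).1.trans_le (hle 1), hsup.trans hμ₀'.2⟩
  have hp := JacobiBasis.nome_mem_Ioo hs
  have hpq : JacobiBasis.nome (⨆ n, μ n) < q₀ := by
    have := JacobiBasis.nome_strictMonoOn hs hμ₀' hsup
    rwa [hμ, JacobiBasis.nome_thetaModulus ht, ← hq] at this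
  choose f hf hfs using fun n => JacobiBasis.exists_hasSum_g 𝕜 n (hμn n)
  refine ⟨f, hf, JacobiBasis.isRieszBasis_of_hasSum (JacobiBasis.sineBasis 𝕜)
    JacobiBasis.oddMul_injective (fun n => PNat.coe_injective (by simp [JacobiBasis.oddMul]))
    (a := fun j n => JacobiBasis.coeff (JacobiBasis.nome (μ n)) j)
    (fun n => JacobiBasis.coeff_zero (JacobiBasis.nome_mem_Ioo (hμn n)))
    -- By monotonicity, the coefficients at the nome of the supremum dominate those for every `n`.
    (d := fun j => JacobiBasis.coeff (JacobiBasis.nome (⨆ n, μ n)) (j + 1))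
    ((summable_nat_add_iff 1).2 (JacobiBasis.summable_coeff hp)) (fun j n => ?_)
    (fun j => (JacobiBasis.coeff_pos hp _).le) ?_ hfs⟩
  · have hn := JacobiBasis.nome_mem_Ioo (hμn n)
    rw [abs_of_pos (JacobiBasis.coeff_pos hn _)]
    rcases (hle n).eq_or_lt with h | h
    · rw [h]
    · exact (JacobiBasis.coeff_le_coeff hn hp
        (JacobiBasis.nome_strictMonoOn (hμn n) hs h) j).2.le
  -- The sum is exactly one at `q₀`, hence strictly smaller at the smaller nome.
  · rw [← JacobiBasis.tsum_coeff_succ_eq_one hq₀ htwo]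
    exact JacobiBasis.tsum_coeff_succ_lt hp hq₀ hpq
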